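/- Let $m\ge 1$, let $n_1,\dots,n_m$ be positive integers, put $n_{m+1}=n_1$, and let $j,r$ be non-negative integers with $j\le m$. Write $[n]=1+q+\cdots+q^{n-1}$, and let ${n\brack k}=\prod_{i=1}^{k}\frac{1-q^{n-i+1}}{1-q^{i}}$ for integers $k\ge 0$ and ${n\brack k}=0$ for $k<0$. Then in the Laurent polynomial ring $\mathbb Z[q,q^{-1}]$ both sums $$\sum_{k=0}^{n_1} q^{j(k^2+k)-(2r+1)k}\,[2k+1]^{2r+1}\prod_{i=1}^m {n_i+n_{i+1}+1\brack n_i-k}$$ and $$\sum_{k=0}^{n_1}(-1)^k q^{\binom k2+j(k^2+k)-2rk}\,[2k+1]^{2r+1}\prod_{i=1}^m {n_i+n_{i+1}+1\brack n_i-k}$$ are divisible by $[n_1+n_m+1]{n_1+n_m\brack n_1}$. -/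

import Mathlib

open LaurentPolynomial

/-- The `q`-integer `[n] = 1 + q + ⋯ + q ^ (n - 1)` in `ℤ[q, q⁻¹]`, with `q = T 1`. -/
noncomputable def qInt (n : ℕ) : ℤ[T;T⁻¹] :=
  ∑ i ∈ Finset.range n, T (i : ℤ)

/-- The `q`-binomial coefficient with natural lower index, by the `q`-Pascal rule.
`qBinomNat_mul_prod` shows that it is the usual product of quotients. -/
noncomputable def qBinomNat : ℕ → ℕ → ℤ[T;T⁻¹]
  | _, 0 => 1
  | 0, _ + 1 => 0
  | n + 1, k + 1 => qBinomNat n k + T ((k : ℤ) + 1) * qBinomNat n (k + 1)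

/-- The product formula `∏_{i=1}^k (1 - q ^ (n - i + 1)) / (1 - q ^ i)` with denominators
cleared. As `ℤ[q, q⁻¹]` is a domain and `∏_{i=1}^k (1 - q ^ i) ≠ 0`, it determines the
`q`-binomial coefficient. -/
theorem qBinomNat_mul_prod (n k : ℕ) :
    qBinomNat n k * ∏ i ∈ Finset.Icc 1 k, (1 - T (i : ℤ)) =
      ∏ i ∈ Finset.Icc 1 k, (1 - T ((n : ℤ) - i + 1)) := by
  have key : ∀ n k : ℕ, qBinomNat n k * ∏ i ∈ Finset.range k, (1 - T ((i : ℤ) + 1)) =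
      ∏ i ∈ Finset.range k, (1 - T ((n : ℤ) - i)) := by
    intro n
    induction n with
    | zero =>
      intro k
      cases k with
      | zero => simp [qBinomNat]
      | succ k => simp [qBinomNat, Finset.prod_range_succ']
    | succ n ih =>
      intro k
      cases k with
      | zero => simp [qBinomNat]
      | succ k =>
        have h1 := ih k
        have h2 := ih (k + 1)
        rw [Finset.prod_range_succ, Finset.prod_range_succ] at h2
        rw [Finset.prod_range_succ, Finset.prod_range_succ', qBinomNat]
        have h3 : ∏ i ∈ Finset.range k, (1 - T (((n + 1 : ℕ) : ℤ) - ((i + 1 : ℕ) : ℤ))) =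
            ∏ i ∈ Finset.range k, ((1 : ℤ[T;T⁻¹]) - T ((n : ℤ) - i)) := by
          refine Finset.prod_congr rfl fun i _ => ?_
          congr 2
          push_cast
          ring
        have h4 : (T (((n + 1 : ℕ) : ℤ) - ((0 : ℕ) : ℤ)) : ℤ[T;T⁻¹]) =
            T ((k : ℤ) + 1) * T ((n : ℤ) - k) := by
          rw [← T_add]
          congr 1
          push_cast
          ring
        rw [h3, h4]
        linear_combination (1 - T ((k : ℤ) + 1)) * h1 + T ((k : ℤ) + 1) * h2
  have reindex : ∀ f : ℕ → ℤ[T;T⁻¹],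
      ∏ i ∈ Finset.Icc 1 k, f i = ∏ i ∈ Finset.range k, f (i + 1) := by
    intro f
    rw [Finset.range_eq_Ico, Finset.prod_Ico_add' f 0 k 1]
    rfl
  rw [reindex, reindex]
  have h := key n k
  convert h using 2
  · refine Finset.prod_congr rfl fun i _ => ?_
    push_cast
    rfl
  · congr 2
    push_cast
    ring

/-- The `q`-binomial coefficient with integer lower index; it is `0` for a negative one. -/
noncomputable def qBinom (n : ℕ) (k : ℤ) : ℤ[T;T⁻¹] :=
  if 0 ≤ k then qBinomNat n k.toNat else 0

/-! Write (q)_n for `qPoch q n` and B(a,k) = 1/((q)_{a-k} (q)_{a+k+1}). Regrouped around the cycle,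
the product of binomials is ∏ (q)_{n_i+n_{i+1}+1} · ∏ B(n_i,k). The claimed divisor is
(q)_{n_1+n_m+1} / ((1-q) (q)_{n_1} (q)_{n_m}), so dividing by it cuts the cycle open at the edge
from n_m to n_1. The quotient is a `pathSum`, and it has to be shown to lie in ℤ[q,q⁻¹], viewed as a
subring S of its fraction field.

The induction is on the path. By q-Vandermonde, (q)_{a+b+1} B(a,k) B(b,k) is a combination of the
B(s,k), so a path a, b, L becomes a combination of paths s, L whose coefficients are powers of q
times two Gaussian binomials. Splitting the Vandermonde sum the other way expands q^(k²+k) times the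
same product, so each node removed can absorb one factor q^(k²+k) or none. A single node allows j =
0 or 1 by explicit evaluation; hence j ≤ m.

For the power 2r+1, [2k+1]² q^(-2k) is a polynomial in [k][k+1] q^(-k), and multiplying the weight
by the latter preserves integrality by a recurrence for B(a,k) in a (`pathSum_qOblong_mul_mem`). -/

/-- The finite product `(1 - q) (1 - q ^ 2) ⋯ (1 - q ^ n)`. -/
def qPoch {K : Type*} [Field K] (q : K) (n : ℕ) : K :=
  ∏ i ∈ Finset.range n, (1 - q ^ (i + 1))

/-- The reciprocal of `qPoch q (n - k)`, which is `0` for `n < k`. -/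
def qPochRecip {K : Type*} [Field K] (q : K) (n k : ℕ) : K :=
  if k ≤ n then (qPoch q (n - k))⁻¹ else 0

/-- The `q`-binomial coefficient at an element of a field, by the `q`-Pascal rule. -/
def gaussBinom {K : Type*} [Field K] (q : K) : ℕ → ℕ → K
  | _, 0 => 1
  | 0, _ + 1 => 0
  | n + 1, k + 1 => gaussBinom q n k + q ^ (k + 1) * gaussBinom q n (k + 1)

/-- The Bailey kernel `1 / ((q; q)_{a - k} (q; q)_{a + k + 1})`. -/
def baileyKernel {K : Type*} [Field K] (q : K) (a k : ℕ) : K :=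
  qPochRecip q a k / qPoch q (a + k + 1)

/-- The factor of the edge from a node `a` to the head of a path; a path ends in a virtual node
`-1`. -/
def edgeFactor {K : Type*} [Field K] (q : K) (a : ℕ) : List ℕ → K
  | [] => qPoch q a
  | c :: _ => qPoch q (a + c + 1)

/-- The product of the edge factors along a path. -/
def pathFactor {K : Type*} [Field K] (q : K) : List ℕ → K
  | [] => 1
  | a :: L => edgeFactor q a L * pathFactor q L

/-- The normalised sum with weight `w` attached to the path `a :: L`. -/
def pathSum {K : Type*} [Field K] (q : K) (w : ℕ → K) (a : ℕ) (L : List ℕ) : K :=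
  qPoch q a * pathFactor q (a :: L) *
    ∑ k ∈ Finset.range (a + 1), w k * baileyKernel q a k * (L.map (baileyKernel q · k)).prod

/-! ### Reciprocal q-factorials, Gaussian binomials and q-Vandermonde -/

section

variable {K : Type*} [Field K] {q : K}

@[simp] theorem qPoch_zero : qPoch q 0 = 1 := by simp [qPoch]

theorem qPoch_succ (n : ℕ) : qPoch q (n + 1) = qPoch q n * (1 - q ^ (n + 1)) := by
  simp [qPoch, Finset.prod_range_succ]

theorem qPoch_ne_zero (hq : ∀ n : ℕ, 1 - q ^ (n + 1) ≠ 0) (n : ℕ) : qPoch q n ≠ 0 :=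
  Finset.prod_ne_zero_iff.2 fun i _ => hq i

theorem qPochRecip_add (k x : ℕ) : qPochRecip q (k + x) k = (qPoch q x)⁻¹ := by
  simp [qPochRecip]

theorem qPochRecip_of_lt {n k : ℕ} (h : n < k) : qPochRecip q n k = 0 := by
  simp [qPochRecip, h]

theorem qPochRecip_succ_right (hq : ∀ n : ℕ, 1 - q ^ (n + 1) ≠ 0) (k x : ℕ) :
    qPochRecip q (k + x) (k + 1) = (1 - q ^ x) * qPochRecip q (k + x) k := by
  rw [qPochRecip_add]
  cases x with
  | zero => simp [qPochRecip_of_lt]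
  | succ x =>
    rw [show k + (x + 1) = k + 1 + x by ring, qPochRecip_add, qPoch_succ]
    have := hq x
    have := qPoch_ne_zero hq x
    field_simp

theorem baileyKernel_of_lt {a k : ℕ} (h : a < k) : baileyKernel q a k = 0 := by
  simp [baileyKernel, qPochRecip_of_lt h]

theorem baileyKernel_add (k x : ℕ) :
    baileyKernel q (k + x) k = (qPoch q x)⁻¹ / qPoch q (x + (2 * k + 1)) := by
  rw [baileyKernel, qPochRecip_add]
  congr 2
  ring

theorem gaussBinom_eq (hq : ∀ n : ℕ, 1 - q ^ (n + 1) ≠ 0) (n k : ℕ) :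
    gaussBinom q n k = qPoch q n * qPochRecip q n k / qPoch q k := by
  have hP := qPoch_ne_zero hq
  induction n generalizing k with
  | zero => cases k <;> simp [gaussBinom, qPochRecip]
  | succ n ih =>
    cases k with
    | zero =>
      have := qPochRecip_add (q := q) 0 (n + 1)
      rw [zero_add] at this
      have := hP (n + 1)
      simp_all [gaussBinom]
    | succ k =>
      rw [gaussBinom, ih, ih]
      rcases lt_trichotomy n k with h | rfl | h
      · simp [qPochRecip_of_lt, h, h.trans (Nat.lt_succ_self k)]
      · have h1 := hP n
        have h2 := hq n
        simp [qPochRecip, qPoch_succ, h1, h2]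
      · obtain ⟨x, rfl⟩ := Nat.exists_eq_add_of_lt h
        rw [show k + x + 1 + 1 = (k + 1) + (x + 1) by ring, qPochRecip_add,
          show (k + 1) + (x + 1) = k + x + 1 + 1 by ring, qPoch_succ (k + x + 1),
          show k + x + 1 = (k + 1) + x by ring, qPochRecip_add,
          show k + 1 + x = k + (x + 1) by ring, qPochRecip_add, qPoch_succ x, qPoch_succ k]
        have h1 := hP k
        have h2 := hP x
        have h3 := hq k
        have h4 := hq x
        field_simp
        ring

theorem gaussBinom_of_lt {n k : ℕ} (h : n < k) : gaussBinom q n k = 0 := by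
  induction n generalizing k with
  | zero => obtain ⟨k, rfl⟩ := Nat.exists_eq_succ_of_ne_zero h.ne'; rfl
  | succ n ih =>
    obtain ⟨k, rfl⟩ := Nat.exists_eq_succ_of_ne_zero (Nat.ne_zero_of_lt h)
    rw [gaussBinom, ih (by omega), ih (by omega)]
    simp

theorem gaussBinom_mem {S : Subring K} (hS : q ∈ S) (n k : ℕ) : gaussBinom q n k ∈ S := by
  induction n generalizing k with
  | zero => cases k <;> simp [gaussBinom, S.one_mem, S.zero_mem]
  | succ n ih =>
    cases k with
    | zero => exact S.one_mem
    | succ k => exact S.add_mem (ih _) (S.mul_mem (S.pow_mem hS _) (ih _))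

/-- The `q`-Vandermonde convolution. -/
theorem gaussBinom_add (m n k : ℕ) :
    gaussBinom q (m + n) k = ∑ p ∈ Finset.HasAntidiagonal.antidiagonal k,
      q ^ ((m - p.1) * p.2) * gaussBinom q m p.1 * gaussBinom q n p.2 := by
  induction m generalizing k with
  | zero =>
    cases k with
    | zero => simp [gaussBinom]
    | succ k => simp [Finset.Nat.sum_antidiagonal_succ, gaussBinom]
  | succ m ih =>
    cases k with
    | zero => simp [gaussBinom]
    | succ k =>
      rw [show m + 1 + n = m + n + 1 by ring, gaussBinom, ih k, ih (k + 1),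
        Finset.Nat.sum_antidiagonal_succ, Finset.Nat.sum_antidiagonal_succ, mul_add,
        Finset.mul_sum, add_left_comm, ← Finset.sum_add_distrib]
      congr 1
      · simp only [gaussBinom]
        simp only [tsub_zero, mul_one, ← mul_assoc, ← pow_add]
        congr 2
        ring
      · refine Finset.sum_congr rfl fun p hp => ?_
        have hk : p.1 + p.2 = k := Finset.HasAntidiagonal.mem_antidiagonal.1 hp
        rw [gaussBinom, Nat.add_sub_add_right]
        -- The exponent m - (p.1 + 1) truncates only where the binomial it multiplies vanishes.
        rcases lt_or_ge m (p.1 + 1) with h | h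
        · rw [gaussBinom_of_lt h]
          ring
        · obtain ⟨d, rfl⟩ := Nat.exists_eq_add_of_le h
          rw [show p.1 + 1 + d - p.1 = d + 1 by omega, show p.1 + 1 + d - (p.1 + 1) = d by omega,
            ← hk]
          ring

/-! ### Merging two Bailey kernels -/

/-- Summation over the common node, for two Bailey kernels with the same second argument. -/
theorem qPoch_mul_baileyKernel_mul_baileyKernel (hq : ∀ n : ℕ, 1 - q ^ (n + 1) ≠ 0)
    (a b k : ℕ) :
    qPoch q (a + b + 1) * baileyKernel q a k * baileyKernel q b k =
      ∑ s ∈ Finset.range (a + 1), q ^ ((a - s) * (b - s)) * qPochRecip q a s * qPochRecip q b s *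
        baileyKernel q s k := by
  have hP := qPoch_ne_zero hq
  rcases lt_or_ge a k with h | ha
  · rw [baileyKernel_of_lt h, Finset.sum_eq_zero]
    · ring
    · intro s hs
      rw [baileyKernel_of_lt (k := k) (by rw [Finset.mem_range] at hs; omega), mul_zero]
  rcases lt_or_ge b k with h | hb
  · rw [baileyKernel_of_lt h, Finset.sum_eq_zero]
    · ring
    · intro s hs
      rcases lt_or_ge b s with h' | h'
      · rw [qPochRecip_of_lt h']
        ring
      · rw [baileyKernel_of_lt (k := k) (by omega), mul_zero]
  obtain ⟨x, rfl⟩ := Nat.exists_eq_add_of_le ha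
  obtain ⟨y, rfl⟩ := Nat.exists_eq_add_of_le hb
  rw [add_assoc k x 1, Finset.sum_range_add, Finset.sum_eq_zero (s := Finset.range k), zero_add]
  swap
  · intro s hs
    rw [baileyKernel_of_lt (Finset.mem_range.1 hs), mul_zero]
  -- With a = k + x, b = k + y, s = k + i, the top x + y + 2k + 1 is split with y first; the
  -- exponent (y - i)(x - i) is (b - s)(a - s).
  have hV := gaussBinom_add (q := q) y (x + (2 * k + 1)) x
  rw [gaussBinom_eq hq, show y + (x + (2 * k + 1)) = x + (y + (2 * k + 1)) by ring,
    qPochRecip_add, Finset.Nat.sum_antidiagonal_eq_sum_range_succ_mk] at hV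
  rw [baileyKernel_add, baileyKernel_add,
    show k + x + (k + y) + 1 = x + (y + (2 * k + 1)) by ring]
  have hL : qPoch q (x + (y + (2 * k + 1))) * ((qPoch q x)⁻¹ / qPoch q (x + (2 * k + 1))) *
      ((qPoch q y)⁻¹ / qPoch q (y + (2 * k + 1))) =
      (qPoch q y)⁻¹ * (qPoch q (x + (2 * k + 1)))⁻¹ *
        (qPoch q (x + (y + (2 * k + 1))) * (qPoch q (y + (2 * k + 1)))⁻¹ / qPoch q x) := by
    ring
  rw [hL, hV, Finset.mul_sum]
  refine Finset.sum_congr rfl fun i hi => ?_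
  obtain ⟨d, rfl⟩ := Nat.exists_eq_add_of_le (Nat.lt_succ_iff.1 (Finset.mem_range.1 hi))
  simp only [gaussBinom_eq hq, baileyKernel_add]
  rw [show i + d - i = d by omega, show i + d + (2 * k + 1) = d + (i + (2 * k + 1)) by ring,
    qPochRecip_add, show k + (i + d) = k + i + d by ring, qPochRecip_add,
    show qPochRecip q (k + y) (k + i) = qPochRecip q y i by simp [qPochRecip, Nat.add_sub_add_left],
    show k + i + d - (k + i) = d by omega, Nat.add_sub_add_left, mul_comm d]
  have h1 := hP y
  have h2 := hP (d + (i + (2 * k + 1)))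
  have h3 := hP i
  have h4 := hP d
  have h5 := hP (i + (2 * k + 1))
  field_simp

/-- Summation over the common node, for two Bailey kernels with the same second argument, with a
quadratic power of `q` on both sides. -/
theorem pow_mul_qPoch_mul_baileyKernel_mul_baileyKernel (hq : ∀ n : ℕ, 1 - q ^ (n + 1) ≠ 0)
    (a b k : ℕ) :
    q ^ (k ^ 2 + k) * (qPoch q (a + b + 1) * baileyKernel q a k * baileyKernel q b k) =
      ∑ s ∈ Finset.range (a + 1), q ^ (s ^ 2 + s) * qPochRecip q a s * qPochRecip q b s *
        baileyKernel q s k := by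
  have hP := qPoch_ne_zero hq
  rcases lt_or_ge a k with h | ha
  · rw [baileyKernel_of_lt h, Finset.sum_eq_zero]
    · ring
    · intro s hs
      rw [baileyKernel_of_lt (k := k) (by rw [Finset.mem_range] at hs; omega), mul_zero]
  rcases lt_or_ge b k with h | hb
  · rw [baileyKernel_of_lt h, Finset.sum_eq_zero]
    · ring
    · intro s hs
      rcases lt_or_ge b s with h' | h'
      · rw [qPochRecip_of_lt h']
        ring
      · rw [baileyKernel_of_lt (k := k) (by omega), mul_zero]
  obtain ⟨x, rfl⟩ := Nat.exists_eq_add_of_le ha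
  obtain ⟨y, rfl⟩ := Nat.exists_eq_add_of_le hb
  rw [add_assoc k x 1, Finset.sum_range_add, Finset.sum_eq_zero (s := Finset.range k), zero_add]
  swap
  · intro s hs
    rw [baileyKernel_of_lt (Finset.mem_range.1 hs), mul_zero]
  -- With y second, the exponent becomes (i + 2k + 1) i, which is (s² + s) - (k² + k) for s = k + i.
  have hV := gaussBinom_add (q := q) (x + (2 * k + 1)) y x
  rw [gaussBinom_eq hq, show x + (2 * k + 1) + y = x + (y + (2 * k + 1)) by ring,
    qPochRecip_add, ← Finset.Nat.sum_antidiagonal_swap,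
    Finset.Nat.sum_antidiagonal_eq_sum_range_succ_mk] at hV
  rw [baileyKernel_add, baileyKernel_add,
    show k + x + (k + y) + 1 = x + (y + (2 * k + 1)) by ring]
  have hL : q ^ (k ^ 2 + k) * (qPoch q (x + (y + (2 * k + 1))) *
      ((qPoch q x)⁻¹ / qPoch q (x + (2 * k + 1))) *
      ((qPoch q y)⁻¹ / qPoch q (y + (2 * k + 1)))) =
      q ^ (k ^ 2 + k) * (qPoch q y)⁻¹ * (qPoch q (x + (2 * k + 1)))⁻¹ *
        (qPoch q (x + (y + (2 * k + 1))) * (qPoch q (y + (2 * k + 1)))⁻¹ / qPoch q x) := by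
    ring
  rw [hL, hV, Finset.mul_sum]
  refine Finset.sum_congr rfl fun i hi => ?_
  obtain ⟨d, rfl⟩ := Nat.exists_eq_add_of_le (Nat.lt_succ_iff.1 (Finset.mem_range.1 hi))
  simp only [gaussBinom_eq hq, baileyKernel_add, Prod.swap]
  rw [show i + d - i = d by omega, show i + d + (2 * k + 1) = d + (i + (2 * k + 1)) by ring,
    qPochRecip_add, show k + (i + d) = k + i + d by ring, qPochRecip_add,
    show qPochRecip q (k + y) (k + i) = qPochRecip q y i by simp [qPochRecip, Nat.add_sub_add_left],
    show d + (i + (2 * k + 1)) - d = i + (2 * k + 1) by omega]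
  have h1 := hP y
  have h2 := hP (d + (i + (2 * k + 1)))
  have h3 := hP i
  have h4 := hP d
  have h5 := hP (i + (2 * k + 1))
  field_simp
  ring

/-! ### Integrality by induction on the path -/

theorem edgeFactor_ne_zero (hq : ∀ n : ℕ, 1 - q ^ (n + 1) ≠ 0) (a : ℕ) (L : List ℕ) :
    edgeFactor q a L ≠ 0 := by
  cases L <;> exact qPoch_ne_zero hq _

/-- The ratio is a Gaussian binomial: b over s at the end of the path, and b + c + 1 over s + c + 1
before a node c. -/
theorem edgeFactor_ratio_mem (hq : ∀ n : ℕ, 1 - q ^ (n + 1) ≠ 0) {S : Subring K} (hS : q ∈ S)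
    (b s : ℕ) (L : List ℕ) : edgeFactor q b L * qPochRecip q b s / edgeFactor q s L ∈ S := by
  cases L with
  | nil => exact gaussBinom_eq hq b s ▸ gaussBinom_mem hS b s
  | cons c L =>
    have h := gaussBinom_mem hS (b + c + 1) (s + c + 1)
    rw [gaussBinom_eq hq] at h
    have h' : qPochRecip q (b + c + 1) (s + c + 1) = qPochRecip q b s := by
      simp only [qPochRecip, add_assoc, add_le_add_iff_right, Nat.add_sub_add_right]
    rwa [h'] at h

/-- If the head node of a path sum splits off a factor, then summing over the new head node
preserves integrality. -/
theorem pathSum_cons_mem_of_kernel (hq : ∀ n : ℕ, 1 - q ^ (n + 1) ≠ 0) {S : Subring K}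
    (hS : q ∈ S) {w w' : ℕ → K} {L : List ℕ} (hw : ∀ s, pathSum q w s L ∈ S) (a b : ℕ)
    (e : ℕ → ℕ)
    (he : ∀ k, w' k * (qPoch q (a + b + 1) * baileyKernel q a k * baileyKernel q b k) =
      w k * ∑ s ∈ Finset.range (a + 1), q ^ e s * qPochRecip q a s * qPochRecip q b s *
        baileyKernel q s k) :
    pathSum q w' a (b :: L) ∈ S := by
  -- Extracting the normalisation of s :: L turns (q)_a / ((q)_{a-s} (q)_s) into a Gaussian binomial
  -- and leaves the edge ratio as the other coefficient.
  have key : pathSum q w' a (b :: L) = ∑ s ∈ Finset.range (a + 1),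
      q ^ e s * gaussBinom q a s * (edgeFactor q b L * qPochRecip q b s / edgeFactor q s L) *
        pathSum q w s L := by
    have hsum : qPoch q (a + b + 1) * ∑ k ∈ Finset.range (a + 1), w' k * baileyKernel q a k *
        ((b :: L).map (baileyKernel q · k)).prod =
        ∑ s ∈ Finset.range (a + 1), q ^ e s * qPochRecip q a s * qPochRecip q b s *
          ∑ k ∈ Finset.range (s + 1), w k * baileyKernel q s k *
            (L.map (baileyKernel q · k)).prod := by
      calc _ = ∑ k ∈ Finset.range (a + 1), ∑ s ∈ Finset.range (a + 1),
            q ^ e s * qPochRecip q a s * qPochRecip q b s *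
              (w k * baileyKernel q s k * (L.map (baileyKernel q · k)).prod) := by
            rw [Finset.mul_sum]
            refine Finset.sum_congr rfl fun k _ => ?_
            have := he k
            rw [List.map_cons, List.prod_cons]
            calc _ = w' k * (qPoch q (a + b + 1) * baileyKernel q a k * baileyKernel q b k) *
                  (L.map (baileyKernel q · k)).prod := by ring
              _ = _ := by
                rw [this, Finset.mul_sum, Finset.sum_mul]
                exact Finset.sum_congr rfl fun s _ => by ring
        _ = _ := by
            rw [Finset.sum_comm]
            refine Finset.sum_congr rfl fun s hs => ?_
            rw [← Finset.mul_sum]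
            congr 1
            symm
            refine Finset.sum_subset (Finset.range_subset_range.2 ?_) fun k _ hk => ?_
            · exact Finset.mem_range.1 hs
            · rw [baileyKernel_of_lt (k := k) (by rw [Finset.mem_range] at hk; omega)]
              ring
    calc _ = qPoch q a * pathFactor q (b :: L) * (qPoch q (a + b + 1) *
          ∑ k ∈ Finset.range (a + 1), w' k * baileyKernel q a k *
            ((b :: L).map (baileyKernel q · k)).prod) := by
          simp only [pathSum, pathFactor, edgeFactor]
          ring
      _ = _ := by
          rw [hsum, Finset.mul_sum]
          refine Finset.sum_congr rfl fun s _ => ?_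
          rw [gaussBinom_eq hq, pathSum, pathFactor, pathFactor]
          have h1 := edgeFactor_ne_zero hq s L
          have h2 := qPoch_ne_zero hq s
          field_simp
  rw [key]
  exact S.sum_mem fun s _ => S.mul_mem (S.mul_mem (S.mul_mem (S.pow_mem hS _)
    (gaussBinom_mem hS _ _)) (edgeFactor_ratio_mem hq hS _ _ _)) (hw s)

theorem pathSum_cons_mem (hq : ∀ n : ℕ, 1 - q ^ (n + 1) ≠ 0) {S : Subring K} (hS : q ∈ S)
    {w : ℕ → K} {L : List ℕ} (hw : ∀ s, pathSum q w s L ∈ S) (a b : ℕ) :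
    pathSum q w a (b :: L) ∈ S :=
  pathSum_cons_mem_of_kernel hq hS hw a b _ fun k => by
    rw [qPoch_mul_baileyKernel_mul_baileyKernel hq]

theorem pathSum_pow_mul_cons_mem (hq : ∀ n : ℕ, 1 - q ^ (n + 1) ≠ 0) {S : Subring K}
    (hS : q ∈ S) {w : ℕ → K} {L : List ℕ} (hw : ∀ s, pathSum q w s L ∈ S) (a b : ℕ) :
    pathSum q (fun k => q ^ (k ^ 2 + k) * w k) a (b :: L) ∈ S :=
  pathSum_cons_mem_of_kernel hq hS hw a b _ fun k => by
    rw [mul_comm _ (w k), mul_assoc, pow_mul_qPoch_mul_baileyKernel_mul_baileyKernel hq]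

theorem pathSum_quadratic_mem (hq : ∀ n : ℕ, 1 - q ^ (n + 1) ≠ 0) {S : Subring K}
    (hS : q ∈ S) {w : ℕ → K} (h0 : ∀ a, pathSum q w a [] ∈ S)
    (h1 : ∀ a, pathSum q (fun k => q ^ (k ^ 2 + k) * w k) a [] ∈ S) (L : List ℕ) (j : ℕ)
    (hj : j ≤ L.length + 1) (a : ℕ) :
    pathSum q (fun k => q ^ (j * (k ^ 2 + k)) * w k) a L ∈ S := by
  induction L generalizing j a with
  | nil =>
    obtain rfl | rfl : j = 0 ∨ j = 1 := by simp at hj; omega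
    · simpa using h0 a
    · simpa using h1 a
  | cons b L ih =>
    -- If j exceeds what the shorter path can carry, one factor q^(k²+k) is spent on this merge;
    -- otherwise the plain merge is used.
    rcases Nat.lt_or_ge (L.length + 1) j with h | h
    · obtain ⟨j, rfl⟩ := Nat.exists_eq_succ_of_ne_zero (Nat.ne_zero_of_lt h)
      have := pathSum_pow_mul_cons_mem hq hS (ih j (by simp at hj; omega)) a b
      convert this using 2
      funext k
      rw [Nat.succ_mul, pow_add]
      ring
    · exact pathSum_cons_mem hq hS (ih j h) a b

theorem pathSum_congr {w w' : ℕ → K} (h : ∀ k, w k = w' k) (a : ℕ) (L : List ℕ) :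
    pathSum q w a L = pathSum q w' a L := by
  rw [funext h]

theorem pathSum_add (w w' : ℕ → K) (a : ℕ) (L : List ℕ) :
    pathSum q (fun k => w k + w' k) a L = pathSum q w a L + pathSum q w' a L := by
  simp only [pathSum, add_mul, Finset.sum_add_distrib, mul_add]

theorem pathSum_const_mul (c : K) (w : ℕ → K) (a : ℕ) (L : List ℕ) :
    pathSum q (fun k => c * w k) a L = c * pathSum q w a L := by
  simp only [pathSum, Finset.mul_sum]
  exact Finset.sum_congr rfl fun k _ => by ring

/-! ### Odd powers of [2k+1] -/

/-- The product `[k] [k + 1] / q ^ k` of `q`-integers. -/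
def qOblong {K : Type*} [Field K] (q : K) (k : ℕ) : K :=
  (1 - q ^ k) / (1 - q) * ((1 - q ^ (k + 1)) / (1 - q)) * q⁻¹ ^ k

theorem one_sub_pow_div_mem (hq : ∀ n : ℕ, 1 - q ^ (n + 1) ≠ 0) {S : Subring K} (hS : q ∈ S)
    (n : ℕ) : (1 - q ^ n) / (1 - q) ∈ S := by
  have h : (1 - q ^ n) / (1 - q) = ∑ i ∈ Finset.range n, q ^ i := by
    have := hq 0
    rw [zero_add, pow_one] at this
    rw [div_eq_iff this, mul_comm, mul_neg_geom_sum]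
  rw [h]
  exact S.sum_mem fun i _ => S.pow_mem hS i

theorem qOblong_mem (hq : ∀ n : ℕ, 1 - q ^ (n + 1) ≠ 0) {S : Subring K} (hS : q ∈ S)
    (hS' : q⁻¹ ∈ S) (n : ℕ) : qOblong q n ∈ S :=
  S.mul_mem (S.mul_mem (one_sub_pow_div_mem hq hS _) (one_sub_pow_div_mem hq hS _))
    (S.pow_mem hS' _)

theorem edgeFactor_succ_div_mem (hq : ∀ n : ℕ, 1 - q ^ (n + 1) ≠ 0) {S : Subring K} (hS : q ∈ S)
    (a : ℕ) (L : List ℕ) :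
    edgeFactor q (a + 1) L / edgeFactor q a L / (1 - q) ∈ S := by
  obtain ⟨n, h1, h2⟩ : ∃ n, edgeFactor q (a + 1) L = qPoch q (n + 1) ∧
      edgeFactor q a L = qPoch q n := by
    cases L with
    | nil => exact ⟨a, rfl, rfl⟩
    | cons c L => exact ⟨a + c + 1, by rw [edgeFactor]; congr 1; ring, rfl⟩
  rw [h1, h2, qPoch_succ, mul_div_cancel_left₀ _ (qPoch_ne_zero hq n)]
  exact one_sub_pow_div_mem hq hS _

theorem qOblong_mul_baileyKernel_zero (k : ℕ) :
    qOblong q k * baileyKernel q 0 k = 0 := by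
  cases k with
  | zero => simp [qOblong]
  | succ k => rw [baileyKernel_of_lt (by omega), mul_zero]

/-- For n = a + 1, `qOblong q n - qOblong q k` equals [n-k][n+k+1] q^(-n), and (1 - q^(n-k))(1 -
q^(n+k+1)) lowers B(n,k) to B(n-1,k). -/
theorem qOblong_mul_baileyKernel_succ (hq0 : q ≠ 0) (hq : ∀ n : ℕ, 1 - q ^ (n + 1) ≠ 0)
    (a k : ℕ) :
    qOblong q k * baileyKernel q (a + 1) k = qOblong q (a + 1) * baileyKernel q (a + 1) k -
      q⁻¹ ^ (a + 1) / (1 - q) ^ 2 * baileyKernel q a k := by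
  have hP := qPoch_ne_zero hq
  have h0 : 1 - q ≠ 0 := by simpa using hq 0
  rcases lt_trichotomy (a + 1) k with h | rfl | h
  · rw [baileyKernel_of_lt h, baileyKernel_of_lt (by omega)]
    ring
  · rw [baileyKernel_of_lt (Nat.lt_succ_self a)]
    ring
  · obtain ⟨x, rfl⟩ := Nat.exists_eq_add_of_le (Nat.lt_succ_iff.1 h)
    rw [add_assoc, baileyKernel_add, baileyKernel_add, qPoch_succ,
      show x + 1 + (2 * k + 1) = x + (2 * k + 1) + 1 by ring, qPoch_succ (x + (2 * k + 1))]
    have h1 := hP x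
    have h2 := hP (x + (2 * k + 1))
    have h3 := hq x
    have h4 := hq (x + (2 * k + 1))
    simp only [qOblong, inv_pow]
    field_simp
    ring

/-- Only the head kernel is lowered. The normalisations of heads a + 1 and a differ by two factors
of the form 1 - q^i, one from `qPoch` and one from the edge; these absorb the denominator (1 - q)².
-/
theorem pathSum_qOblong_mul_mem (hq0 : q ≠ 0) (hq : ∀ n : ℕ, 1 - q ^ (n + 1) ≠ 0) {S : Subring K}
    (hS : q ∈ S) (hS' : q⁻¹ ∈ S) {w : ℕ → K} {L : List ℕ} (hw : ∀ a, pathSum q w a L ∈ S)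
    (a : ℕ) : pathSum q (fun k => qOblong q k * w k) a L ∈ S := by
  cases a with
  | zero =>
    rw [pathSum, Finset.sum_eq_zero]
    · rw [mul_zero]
      exact S.zero_mem
    · intro k _
      rw [mul_right_comm (qOblong q k), qOblong_mul_baileyKernel_zero]
      ring
  | succ a =>
    have hsum : ∑ k ∈ Finset.range (a + 1 + 1), w k * baileyKernel q a k *
        (L.map (baileyKernel q · k)).prod = ∑ k ∈ Finset.range (a + 1), w k * baileyKernel q a k *
        (L.map (baileyKernel q · k)).prod := by
      rw [Finset.sum_range_succ, baileyKernel_of_lt (Nat.lt_succ_self a)]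
      ring
    have h0 : 1 - q ≠ 0 := by simpa using hq 0
    have key : pathSum q (fun k => qOblong q k * w k) (a + 1) L =
        qOblong q (a + 1) * pathSum q w (a + 1) L -
          q⁻¹ ^ (a + 1) * ((1 - q ^ (a + 1)) / (1 - q)) *
            (edgeFactor q (a + 1) L / edgeFactor q a L / (1 - q)) * pathSum q w a L := by
      simp only [pathSum, pathFactor]
      rw [← hsum]
      have hs : ∑ k ∈ Finset.range (a + 1 + 1), qOblong q k * w k * baileyKernel q (a + 1) k *
          (L.map (baileyKernel q · k)).prod =
          qOblong q (a + 1) * ∑ k ∈ Finset.range (a + 1 + 1), w k * baileyKernel q (a + 1) k *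
            (L.map (baileyKernel q · k)).prod -
          q⁻¹ ^ (a + 1) / (1 - q) ^ 2 * ∑ k ∈ Finset.range (a + 1 + 1), w k * baileyKernel q a k *
            (L.map (baileyKernel q · k)).prod := by
        rw [Finset.mul_sum, Finset.mul_sum, ← Finset.sum_sub_distrib]
        refine Finset.sum_congr rfl fun k _ => ?_
        linear_combination (w k * (L.map (baileyKernel q · k)).prod) *
          qOblong_mul_baileyKernel_succ hq0 hq a k
      rw [hs, qPoch_succ]
      have h1 := edgeFactor_ne_zero hq a L
      field_simp
    rw [key]
    exact S.sub_mem (S.mul_mem (qOblong_mem hq hS hS' _) (hw _))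
      (S.mul_mem (S.mul_mem (S.mul_mem (S.pow_mem hS' _) (one_sub_pow_div_mem hq hS _))
        (edgeFactor_succ_div_mem hq hS _ _)) (hw _))

/-- A q-analogue of (2k+1)² = 1 + 4k(k+1). -/
theorem sq_qInt_eq_qOblong (hq0 : q ≠ 0) (hq : ∀ n : ℕ, 1 - q ^ (n + 1) ≠ 0) (k : ℕ) :
    ((1 - q ^ (2 * k + 1)) / (1 - q)) ^ 2 * q⁻¹ ^ (2 * k) =
      1 + 2 * (1 + q) * qOblong q k + (1 - q) ^ 2 * qOblong q k * qOblong q k := by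
  have h0 : 1 - q ≠ 0 := by simpa using hq 0
  simp only [qOblong, inv_pow]
  field_simp
  ring

theorem pathSum_odd_pow_mem (hq0 : q ≠ 0) (hq : ∀ n : ℕ, 1 - q ^ (n + 1) ≠ 0) {S : Subring K}
    (hS : q ∈ S) (hS' : q⁻¹ ∈ S) {w : ℕ → K} {L : List ℕ} (hw : ∀ a, pathSum q w a L ∈ S)
    (r a : ℕ) :
    pathSum q (fun k => (((1 - q ^ (2 * k + 1)) / (1 - q)) ^ 2 * q⁻¹ ^ (2 * k)) ^ r * w k) a L
      ∈ S := by
  induction r generalizing a with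
  | zero => simpa using hw a
  | succ r ih =>
    have h1 := pathSum_qOblong_mul_mem hq0 hq hS hS' ih
    have h2 := pathSum_qOblong_mul_mem hq0 hq hS hS' h1
    set v : ℕ → K := fun k => (((1 - q ^ (2 * k + 1)) / (1 - q)) ^ 2 * q⁻¹ ^ (2 * k)) ^ r * w k
      with hv
    have key : pathSum q (fun k =>
        (((1 - q ^ (2 * k + 1)) / (1 - q)) ^ 2 * q⁻¹ ^ (2 * k)) ^ (r + 1) * w k) a L =
        pathSum q v a L + 2 * (1 + q) * pathSum q (fun k => qOblong q k * v k) a L +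
          (1 - q) ^ 2 * pathSum q (fun k => qOblong q k * (qOblong q k * v k)) a L := by
      rw [← pathSum_const_mul, ← pathSum_const_mul, ← pathSum_add, ← pathSum_add]
      refine pathSum_congr (fun k => ?_) a L
      rw [hv, pow_succ]
      simp only
      linear_combination ((((1 - q ^ (2 * k + 1)) / (1 - q)) ^ 2 * q⁻¹ ^ (2 * k)) ^ r * w k) *
        sq_qInt_eq_qOblong hq0 hq k
    rw [key]
    have h2S : (2 : K) ∈ S := by
      rw [← one_add_one_eq_two]
      exact S.add_mem S.one_mem S.one_mem
    exact S.add_mem (S.add_mem (ih a) (S.mul_mem (S.mul_mem h2S (S.add_mem S.one_mem hS)) (h1 a)))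
      (S.mul_mem (S.pow_mem (S.sub_mem S.one_mem hS) 2) (h2 a))

/-! ### Evaluation of one-node paths -/

theorem pathSum_nil (w : ℕ → K) (a : ℕ) :
    pathSum q w a [] = qPoch q a ^ 2 * ∑ k ∈ Finset.range (a + 1), w k * baileyKernel q a k := by
  simp [pathSum, pathFactor, edgeFactor, sq]

theorem baileyKernel_eq_div (hq : ∀ n : ℕ, 1 - q ^ (n + 1) ≠ 0) (a k : ℕ) :
    qPochRecip q a k / qPoch q (a + k) = (1 - q ^ (a + k + 1)) * baileyKernel q a k := by
  rw [baileyKernel, qPoch_succ]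
  have := hq (a + k)
  field_simp

theorem qPochRecip_succ_div (hq : ∀ n : ℕ, 1 - q ^ (n + 1) ≠ 0) (k x : ℕ) :
    qPochRecip q (k + x) (k + 1) / qPoch q (k + x + (k + 1)) =
      (1 - q ^ x) * baileyKernel q (k + x) k := by
  rw [qPochRecip_succ_right hq, baileyKernel, mul_div_assoc]
  rfl

/-- A sum over `Finset.range (a + 1)` against the Bailey kernel telescopes when its weight
satisfies the given three-term relation. -/
theorem sum_mul_baileyKernel_of_telescope (hq : ∀ n : ℕ, 1 - q ^ (n + 1) ≠ 0) (w g : ℕ → K) (a : ℕ)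
    (h : ∀ k x, k + x = a → w k = g k * (1 - q ^ (a + k + 1)) - g (k + 1) * (1 - q ^ x)) :
    ∑ k ∈ Finset.range (a + 1), w k * baileyKernel q a k = g 0 * (qPoch q a ^ 2)⁻¹ := by
  have hk : ∀ k ∈ Finset.range (a + 1), w k * baileyKernel q a k =
      g k * (qPochRecip q a k / qPoch q (a + k)) -
        g (k + 1) * (qPochRecip q a (k + 1) / qPoch q (a + (k + 1))) := by
    intro k hk
    obtain ⟨x, rfl⟩ := Nat.exists_eq_add_of_le (Nat.lt_succ_iff.1 (Finset.mem_range.1 hk))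
    rw [baileyKernel_eq_div hq, qPochRecip_succ_div hq, h k x rfl]
    ring
  -- The upper boundary term, at k = a + 1, vanishes because `qPochRecip` is 0 there.
  rw [Finset.sum_congr rfl hk, Finset.sum_range_sub'
    (fun k => g k * (qPochRecip q a k / qPoch q (a + k))), qPochRecip_of_lt (Nat.lt_succ_self a)]
  simp only [qPochRecip, Nat.zero_le, if_true, tsub_zero, add_zero]
  ring

theorem pathSum_nil_of_telescope (hq : ∀ n : ℕ, 1 - q ^ (n + 1) ≠ 0) (w g : ℕ → K) (a : ℕ)
    (h : ∀ k x, k + x = a → w k = g k * (1 - q ^ (a + k + 1)) - g (k + 1) * (1 - q ^ x)) :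
    pathSum q w a [] = g 0 := by
  rw [pathSum_nil, sum_mul_baileyKernel_of_telescope hq w g a h]
  have := qPoch_ne_zero hq a
  field_simp

theorem pathSum_nil_inv_pow (hq0 : q ≠ 0) (hq : ∀ n : ℕ, 1 - q ^ (n + 1) ≠ 0) (a : ℕ) :
    pathSum q (fun k => q⁻¹ ^ k * (1 - q ^ (2 * k + 1))) a [] = q⁻¹ ^ a := by
  refine pathSum_nil_of_telescope hq _ (fun _ => q⁻¹ ^ a) a ?_
  rintro k x rfl
  simp only [inv_pow]
  field_simp
  ring

theorem pathSum_nil_pow_mul_inv_pow (hq0 : q ≠ 0) (hq : ∀ n : ℕ, 1 - q ^ (n + 1) ≠ 0) (a : ℕ) :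
    pathSum q (fun k => q ^ (k ^ 2 + k) * (q⁻¹ ^ k * (1 - q ^ (2 * k + 1)))) a [] = 1 := by
  rw [pathSum_nil_of_telescope hq _ (fun k => q ^ k ^ 2) a]
  · simp
  rintro k x rfl
  simp only [inv_pow]
  field_simp
  ring

theorem choose_two_succ (k : ℕ) : (k + 1).choose 2 = k.choose 2 + k := by
  rw [Nat.choose_succ_succ' k 1, Nat.choose_one_right, add_comm]

theorem pathSum_nil_alternating (hq : ∀ n : ℕ, 1 - q ^ (n + 1) ≠ 0) (a : ℕ) :
    pathSum q (fun k => (-1) ^ k * q ^ k.choose 2 * (1 - q ^ (2 * k + 1))) a [] =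
      if a = 0 then 1 else 0 := by
  -- The antidifference carries the factor 1/(1 - q^a), so a = 0 is separate; for a > 0 it vanishes
  -- at k = 0.
  cases a with
  | zero =>
    have := hq 0
    simp_all [pathSum_nil, baileyKernel, qPochRecip, qPoch_succ]
  | succ a =>
    rw [pathSum_nil_of_telescope hq _
      (fun k => (1 - q ^ (a + 1))⁻¹ * ((-1) ^ k * q ^ k.choose 2 * (1 - q ^ k))) (a + 1)]
    · simp
    · intro k x hx
      have h := hq a
      rw [choose_two_succ]
      field_simp
      rw [← hx]
      ring

/-- Creative telescoping: if S(a) is the sum, the summand of (1 - q^(a+1)) S(a+1) - S(a) has an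
explicit antidifference vanishing at k = 0, so (1 - q^(a+1)) S(a+1) = S(a). -/
theorem qPoch_mul_sum_alternating (hq : ∀ n : ℕ, 1 - q ^ (n + 1) ≠ 0) (a : ℕ) :
    qPoch q a * ∑ k ∈ Finset.range (a + 1), q ^ (k ^ 2 + k) *
      ((-1) ^ k * q ^ k.choose 2 * (1 - q ^ (2 * k + 1))) * baileyKernel q a k = 1 := by
  induction a with
  | zero =>
    have := hq 0
    simp_all [baileyKernel, qPochRecip, qPoch_succ]
  | succ a ih =>
    have hext : ∑ k ∈ Finset.range (a + 1), q ^ (k ^ 2 + k) *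
        ((-1) ^ k * q ^ k.choose 2 * (1 - q ^ (2 * k + 1))) * baileyKernel q a k =
        ∑ k ∈ Finset.range (a + 1 + 1), q ^ (k ^ 2 + k) *
        ((-1) ^ k * q ^ k.choose 2 * (1 - q ^ (2 * k + 1))) * baileyKernel q a k := by
      rw [Finset.sum_range_succ _ (a + 1), baileyKernel_of_lt (Nat.lt_succ_self a)]
      ring
    rw [hext] at ih
    -- Both sums can then be written with B(a+1,k); at k = a + 1 both sides are 0.
    have hrec : ∀ k ∈ Finset.range (a + 1 + 1), baileyKernel q a k =
        (1 - q ^ (a + 1 - k)) * (1 - q ^ (a + 1 + k + 1)) * baileyKernel q (a + 1) k := by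
      intro k hk
      obtain ⟨x, hx⟩ := Nat.exists_eq_add_of_le (Nat.lt_succ_iff.1 (Finset.mem_range.1 hk))
      rw [hx, Nat.add_sub_cancel_left]
      cases x with
      | zero => rw [baileyKernel_of_lt (by omega)]; simp
      | succ x =>
        obtain rfl : a = k + x := by omega
        rw [baileyKernel_add, baileyKernel_add, qPoch_succ,
          show x + 1 + (2 * k + 1) = x + (2 * k + 1) + 1 by ring, qPoch_succ (x + (2 * k + 1)),
          show k + (x + 1) + k + 1 = x + (2 * k + 1) + 1 by ring]
        have h1 := qPoch_ne_zero hq x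
        have h2 := qPoch_ne_zero hq (x + (2 * k + 1))
        have h3 := hq x
        have h4 := hq (x + (2 * k + 1))
        field_simp
    have hsum := sum_mul_baileyKernel_of_telescope hq
      (fun k => q ^ (k ^ 2 + k) * ((-1) ^ k * q ^ k.choose 2 * (1 - q ^ (2 * k + 1))) *
        ((1 - q ^ (a + 1)) - (1 - q ^ (a + 1 - k)) * (1 - q ^ (a + 1 + k + 1))))
      (fun k => (-1) ^ k * q ^ (k.choose 2 + k ^ 2 + (a + 1)) * (1 - q ^ k)) (a + 1) (by
        intro k x hx
        rw [← hx, Nat.add_sub_cancel_left, choose_two_succ]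
        ring)
    have hzero : ∑ k ∈ Finset.range (a + 1 + 1),
        ((1 - q ^ (a + 1)) * (q ^ (k ^ 2 + k) *
          ((-1) ^ k * q ^ k.choose 2 * (1 - q ^ (2 * k + 1))) * baileyKernel q (a + 1) k) -
        q ^ (k ^ 2 + k) * ((-1) ^ k * q ^ k.choose 2 * (1 - q ^ (2 * k + 1))) *
          baileyKernel q a k) = 0 := by
      simp only [pow_zero, sub_self, mul_zero, zero_mul] at hsum
      rw [← hsum]
      refine Finset.sum_congr rfl fun k hk => ?_
      rw [hrec k hk]
      ring
    rw [Finset.sum_sub_distrib, ← Finset.mul_sum] at hzero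
    rw [qPoch_succ]
    linear_combination ih + qPoch q a * hzero

theorem pathSum_nil_pow_mul_alternating (hq : ∀ n : ℕ, 1 - q ^ (n + 1) ≠ 0) (a : ℕ) :
    pathSum q (fun k => q ^ (k ^ 2 + k) * ((-1) ^ k * q ^ k.choose 2 * (1 - q ^ (2 * k + 1)))) a
      [] = qPoch q a := by
  rw [pathSum_nil, sq, mul_assoc, qPoch_mul_sum_alternating hq, mul_one]

theorem qPoch_mem {S : Subring K} (hS : q ∈ S) (n : ℕ) : qPoch q n ∈ S :=
  S.prod_mem fun _ _ => S.sub_mem S.one_mem (S.pow_mem hS _)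

theorem pathSum_positive_mem (hq0 : q ≠ 0) (hq : ∀ n : ℕ, 1 - q ^ (n + 1) ≠ 0) {S : Subring K}
    (hS : q ∈ S) (hS' : q⁻¹ ∈ S) (L : List ℕ) (j r : ℕ) (hj : j ≤ L.length + 1) (a : ℕ) :
    pathSum q (fun k => (((1 - q ^ (2 * k + 1)) / (1 - q)) ^ 2 * q⁻¹ ^ (2 * k)) ^ r *
      (q ^ (j * (k ^ 2 + k)) * (q⁻¹ ^ k * (1 - q ^ (2 * k + 1))))) a L ∈ S := by
  refine pathSum_odd_pow_mem hq0 hq hS hS' (pathSum_quadratic_mem hq hS ?_ ?_ L j hj) r a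
  · exact fun a => pathSum_nil_inv_pow hq0 hq a ▸ S.pow_mem hS' a
  · intro a
    rw [pathSum_nil_pow_mul_inv_pow hq0 hq]
    exact S.one_mem

theorem pathSum_alternating_mem (hq0 : q ≠ 0) (hq : ∀ n : ℕ, 1 - q ^ (n + 1) ≠ 0) {S : Subring K}
    (hS : q ∈ S) (hS' : q⁻¹ ∈ S) (L : List ℕ) (j r : ℕ) (hj : j ≤ L.length + 1) (a : ℕ) :
    pathSum q (fun k => (((1 - q ^ (2 * k + 1)) / (1 - q)) ^ 2 * q⁻¹ ^ (2 * k)) ^ r *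
      (q ^ (j * (k ^ 2 + k)) * ((-1) ^ k * q ^ k.choose 2 * (1 - q ^ (2 * k + 1))))) a L ∈ S := by
  refine pathSum_odd_pow_mem hq0 hq hS hS' (pathSum_quadratic_mem hq hS ?_ ?_ L j hj) r a
  · intro a
    rw [pathSum_nil_alternating hq]
    split_ifs
    exacts [S.one_mem, S.zero_mem]
  · exact fun a => pathSum_nil_pow_mul_alternating hq a ▸ qPoch_mem hS a

end

/-! ### Cutting the cycle open -/

section

variable {K : Type*} [Field K] {q : K}

theorem pathFactor_range (v : ℕ → ℕ) (M : ℕ) :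
    pathFactor q (v 0 :: (List.range M).map fun i => v (i + 1)) =
      (∏ i ∈ Finset.range M, qPoch q (v i + v (i + 1) + 1)) * qPoch q (v M) := by
  induction M generalizing v with
  | zero => simp [pathFactor, edgeFactor]
  | succ M ih =>
    have h := ih fun i => v (i + 1)
    rw [List.range_succ_eq_map, List.map_cons, List.map_map, pathFactor, edgeFactor,
      Finset.prod_range_succ']
    simp only [zero_add, Function.comp_def, Nat.succ_eq_add_one] at h ⊢
    rw [h]
    ring

theorem prod_map_range_mul (f : ℕ → K) (v : ℕ → ℕ) (M : ℕ) :
    f (v 0) * (((List.range M).map fun i => v (i + 1)).map f).prod =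
      ∏ i ∈ Finset.range (M + 1), f (v i) := by
  induction M with
  | zero => simp
  | succ M ih => simp [List.range_succ, Finset.prod_range_succ _ (M + 1), ← ih, mul_assoc]

/-- A cyclic product of `q`-binomial coefficients in terms of Bailey kernels. -/
theorem prod_cyclic_eq (v : ℕ → ℕ) (M : ℕ) (hv : v (M + 1) = v 0) (k : ℕ) :
    ∏ i ∈ Finset.range (M + 1),
        (qPoch q (v i + v (i + 1) + 1) * qPochRecip q (v i) k / qPoch q (v (i + 1) + k + 1)) =
      (∏ i ∈ Finset.range (M + 1), qPoch q (v i + v (i + 1) + 1)) *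
        ∏ i ∈ Finset.range (M + 1), baileyKernel q (v i) k := by
  simp only [baileyKernel, Finset.prod_div_distrib, Finset.prod_mul_distrib]
  -- The denominators are indexed by the next node; since v (M + 1) = v 0, the last one moves to the
  -- front and each meets its own node.
  rw [Finset.prod_range_succ (fun i => qPoch q (v (i + 1) + k + 1)), hv,
    ← Finset.prod_range_succ' (fun i => qPoch q (v i + k + 1)), mul_div_assoc]

/-- The path has (q)_{v 0} (q)_{v M} in place of the closing edge factor (q)_{v M + v 0 + 1}; their
quotient, over 1 - q, is the divisor. -/
theorem sum_mul_prod_cyclic (hq : ∀ n : ℕ, 1 - q ^ (n + 1) ≠ 0) (w : ℕ → K) (v : ℕ → ℕ) (M : ℕ)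
    (hv : v (M + 1) = v 0) :
    ∑ k ∈ Finset.range (v 0 + 1), w k / (1 - q) * ∏ i ∈ Finset.range (M + 1),
        (qPoch q (v i + v (i + 1) + 1) * qPochRecip q (v i) k / qPoch q (v (i + 1) + k + 1)) =
      (1 - q ^ (v 0 + v M + 1)) / (1 - q) * gaussBinom q (v 0 + v M) (v 0) *
        pathSum q w (v 0) ((List.range M).map fun i => v (i + 1)) := by
  have h0 := qPoch_ne_zero hq (v 0)
  have h1 := qPoch_ne_zero hq (v M)
  rw [pathSum, pathFactor_range, gaussBinom_eq hq, qPochRecip_add, Finset.mul_sum, Finset.mul_sum]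
  refine Finset.sum_congr rfl fun k _ => ?_
  rw [prod_cyclic_eq v M hv k, Finset.prod_range_succ (fun i => qPoch q (v i + v (i + 1) + 1)), hv,
    mul_assoc (w k), prod_map_range_mul (baileyKernel q · k), add_comm (v M), qPoch_succ]
  field_simp

end

/-! ### Transfer between Laurent polynomials and a field -/

section

variable {K : Type*} [Field K] (φ : ℤ[T;T⁻¹] →+* K)

theorem map_T_natCast (n : ℕ) : φ (T (n : ℤ)) = φ (T 1) ^ n := by
  rw [← map_pow, T_pow, mul_one]

theorem map_T_neg_natCast (n : ℕ) : φ (T (-(n : ℤ))) = (φ (T 1))⁻¹ ^ n := by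
  have h : φ (T (-(n : ℤ))) * φ (T 1) ^ n = 1 := by
    rw [← map_T_natCast, ← map_mul, ← T_add, neg_add_cancel, T_zero, map_one]
  rw [inv_pow]
  exact eq_inv_of_mul_eq_one_left h

theorem map_qBinomNat (n k : ℕ) : φ (qBinomNat n k) = gaussBinom (φ (T 1)) n k := by
  induction n generalizing k with
  | zero => cases k <;> simp [qBinomNat, gaussBinom]
  | succ n ih =>
    cases k with
    | zero => simp [qBinomNat, gaussBinom]
    | succ k =>
      have := map_T_natCast φ (k + 1)
      push_cast at this
      rw [qBinomNat, gaussBinom, map_add, map_mul, ih, ih, this]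

theorem map_qInt (h0 : 1 - φ (T 1) ≠ 0) (n : ℕ) :
    φ (qInt n) = (1 - φ (T 1) ^ n) / (1 - φ (T 1)) := by
  rw [eq_div_iff h0, mul_comm, ← mul_neg_geom_sum, qInt, map_sum]
  simp only [map_T_natCast]

theorem map_qBinom (hq : ∀ n : ℕ, 1 - φ (T 1) ^ (n + 1) ≠ 0) (a b k : ℕ) :
    φ (qBinom (a + b + 1) ((a : ℤ) - k)) =
      qPoch (φ (T 1)) (a + b + 1) * qPochRecip (φ (T 1)) a k / qPoch (φ (T 1)) (b + k + 1) := by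
  rcases lt_or_ge a k with h | h
  · rw [qPochRecip_of_lt h, qBinom, if_neg (by omega)]
    simp
  · obtain ⟨x, rfl⟩ := Nat.exists_eq_add_of_le h
    rw [qBinom, if_pos (by omega), show (((k + x : ℕ) : ℤ) - k).toNat = x by omega, map_qBinomNat,
      gaussBinom_eq hq, qPochRecip_add, show k + x + b + 1 = x + (b + k + 1) by ring,
      qPochRecip_add, div_eq_mul_inv, div_eq_mul_inv]
    ring

/-- A preimage of the path sum is the cofactor, and injectivity of `φ` brings the identity back to
Laurent polynomials. -/
theorem dvd_sum_of_pathSum_mem (hφ : Function.Injective φ)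
    (hq : ∀ n : ℕ, 1 - φ (T 1) ^ (n + 1) ≠ 0) (W : ℕ → ℤ[T;T⁻¹]) (w : ℕ → K)
    (hW : ∀ k, φ (W k) = w k / (1 - φ (T 1))) (n : ℕ → ℕ) (M : ℕ) (hn : n (M + 2) = n 1)
    (h : pathSum (φ (T 1)) w (n 1) ((List.range M).map fun i => n (i + 2)) ∈ φ.range) :
    qInt (n 1 + n (M + 1) + 1) * qBinom (n 1 + n (M + 1)) (n 1 : ℤ) ∣
      ∑ k ∈ Finset.range (n 1 + 1), W k *
        ∏ i ∈ Finset.Icc 1 (M + 1), qBinom (n i + n (i + 1) + 1) ((n i : ℤ) - k) := by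
  obtain ⟨x, hx⟩ := h
  refine ⟨x, hφ ?_⟩
  have h0 : 1 - φ (T 1) ≠ 0 := by simpa using hq 0
  have hsum := sum_mul_prod_cyclic hq w (fun i => n (i + 1)) M hn
  rw [map_mul, map_mul, map_qInt φ h0, qBinom, if_pos (by omega), Int.toNat_natCast,
    map_qBinomNat, hx]
  refine Eq.trans ?_ hsum
  rw [map_sum]
  refine Finset.sum_congr rfl fun k _ => ?_
  rw [map_mul, hW, map_prod, ← Finset.Ico_succ_right_eq_Icc, Finset.prod_Ico_eq_prod_range]
  congr 1
  refine Finset.prod_congr rfl fun i _ => ?_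
  rw [map_qBinom φ hq, add_comm 1 i]

theorem one_sub_T_ne_zero (n : ℕ) : (1 : ℤ[T;T⁻¹]) - T 1 ^ (n + 1) ≠ 0 := by
  rw [T_pow, mul_one, sub_ne_zero, ← T_zero]
  intro h
  have := congrArg (fun f : ℤ[T;T⁻¹] => f.degree) h
  simp only [degree_T] at this
  have h2 := WithBot.coe_injective this
  omega

/-- The power 2r + 1 splits into r copies of [2k+1]² q^(-2k) and one [2k+1] q^(-k), whose
denominator 1 - q is kept outside the weight. -/
theorem map_positive_weight (h0 : 1 - φ (T 1) ≠ 0) (j r k : ℕ) :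
    φ (T ((j : ℤ) * ((k : ℤ) ^ 2 + k) - (2 * (r : ℤ) + 1) * k) * qInt (2 * k + 1) ^ (2 * r + 1)) =
      (((1 - φ (T 1) ^ (2 * k + 1)) / (1 - φ (T 1))) ^ 2 * (φ (T 1))⁻¹ ^ (2 * k)) ^ r *
        (φ (T 1) ^ (j * (k ^ 2 + k)) * ((φ (T 1))⁻¹ ^ k * (1 - φ (T 1) ^ (2 * k + 1)))) /
        (1 - φ (T 1)) := by
  rw [show (j : ℤ) * ((k : ℤ) ^ 2 + k) - (2 * (r : ℤ) + 1) * k =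
      ((j * (k ^ 2 + k) : ℕ) : ℤ) + -(((2 * r + 1) * k : ℕ) : ℤ) by push_cast; ring,
    T_add, map_mul, map_mul, map_pow, map_T_natCast, map_T_neg_natCast, map_qInt φ h0]
  -- As an atom, the difference is not expanded under the symbolic exponent r.
  generalize 1 - φ (T 1) ^ (2 * k + 1) = x
  ring

theorem map_alternating_weight (h0 : 1 - φ (T 1) ≠ 0) (j r k : ℕ) :
    φ ((-1 : ℤ[T;T⁻¹]) ^ k * T ((k.choose 2 : ℤ) + (j : ℤ) * ((k : ℤ) ^ 2 + k) - 2 * (r : ℤ) * k) *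
        qInt (2 * k + 1) ^ (2 * r + 1)) =
      (((1 - φ (T 1) ^ (2 * k + 1)) / (1 - φ (T 1))) ^ 2 * (φ (T 1))⁻¹ ^ (2 * k)) ^ r *
        (φ (T 1) ^ (j * (k ^ 2 + k)) *
          ((-1) ^ k * φ (T 1) ^ k.choose 2 * (1 - φ (T 1) ^ (2 * k + 1)))) /
        (1 - φ (T 1)) := by
  rw [show (k.choose 2 : ℤ) + (j : ℤ) * ((k : ℤ) ^ 2 + k) - 2 * (r : ℤ) * k =
      ((k.choose 2 + j * (k ^ 2 + k) : ℕ) : ℤ) + -((2 * r * k : ℕ) : ℤ) by push_cast; ring,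
    T_add, map_mul, map_mul, map_mul, map_pow, map_pow, map_neg, map_one, map_T_natCast,
    map_T_neg_natCast, map_qInt φ h0]
  generalize 1 - φ (T 1) ^ (2 * k + 1) = x
  ring

end

theorem theorem1p1 (m : ℕ) (hm : 1 ≤ m) (n : ℕ → ℕ)
    (hpos : ∀ i ∈ Finset.Icc 1 m, 0 < n i) (hcyc : n (m + 1) = n 1)
    (j r : ℕ) (hj : j ≤ m) :
    (qInt (n 1 + n m + 1) * qBinom (n 1 + n m) (n 1 : ℤ) ∣
      ∑ k ∈ Finset.range (n 1 + 1),
        T ((j : ℤ) * ((k : ℤ) ^ 2 + k) - (2 * (r : ℤ) + 1) * k) *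
          qInt (2 * k + 1) ^ (2 * r + 1) *
          ∏ i ∈ Finset.Icc 1 m, qBinom (n i + n (i + 1) + 1) ((n i : ℤ) - k)) ∧
    (qInt (n 1 + n m + 1) * qBinom (n 1 + n m) (n 1 : ℤ) ∣
      ∑ k ∈ Finset.range (n 1 + 1),
        (-1 : ℤ[T;T⁻¹]) ^ k *
          T ((k.choose 2 : ℤ) + (j : ℤ) * ((k : ℤ) ^ 2 + k) - 2 * (r : ℤ) * k) *
          qInt (2 * k + 1) ^ (2 * r + 1) *
          ∏ i ∈ Finset.Icc 1 m, qBinom (n i + n (i + 1) + 1) ((n i : ℤ) - k)) := by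
  obtain ⟨M, rfl⟩ := Nat.exists_eq_add_of_le' hm
  set φ := algebraMap ℤ[T;T⁻¹] (FractionRing ℤ[T;T⁻¹]) with hφ_def
  have hφ : Function.Injective φ := IsFractionRing.injective _ _
  have hq : ∀ n : ℕ, 1 - φ (T 1) ^ (n + 1) ≠ 0 := fun n => by
    rw [← map_pow, ← map_one φ, ← map_sub]
    exact (map_ne_zero_iff φ hφ).2 (one_sub_T_ne_zero n)
  have hq0 : φ (T 1) ≠ 0 := ((isUnit_T 1).map φ).ne_zero
  have h0 : 1 - φ (T 1) ≠ 0 := by simpa using hq 0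
  have hS : φ (T 1) ∈ φ.range := ⟨_, rfl⟩
  have hS' : (φ (T 1))⁻¹ ∈ φ.range := ⟨T (-1), by simpa using map_T_neg_natCast φ 1⟩
  have hj' : j ≤ ((List.range M).map fun i => n (i + 2)).length + 1 := by simpa using hj
  exact ⟨dvd_sum_of_pathSum_mem φ hφ hq _ _ (map_positive_weight φ h0 j r) n M hcyc
      (pathSum_positive_mem hq0 hq hS hS' _ j r hj' _),
    dvd_sum_of_pathSum_mem φ hφ hq _ _ (map_alternating_weight φ h0 j r) n M hcyc
      (pathSum_alternating_mem hq0 hq hS hS' _ j r hj' _)⟩
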